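/- Let $R$ be a commutative ring with identity. An ideal $I$ of $R$ is *dense* if $(0:_R I)=\{r\in R\mid Ir=0\}=0$, and *semi-regular* if it contains a finitely generated dense ideal; let $\mathcal{Q}$ be the set of finitely generated semi-regular ideals of $R$. An $R$-module $M$ is *$\mathcal{Q}$-torsion-free* if the only $x\in M$ with $Ix=0$ for some $I\in\mathcal{Q}$ is $x=0$, and a *Lucas module* if it is $\mathcal{Q}$-torsion-free and $\mathrm{Ext}^1_R(R/I,M)=0$ for all $I\in\mathcal{Q}$. A homomorphism $f:N\to M$ is a *pure monomorphism* (it identifies $N$ with a *pure submodule* of $M$) if $A\otimes_R N\to A\otimes_R M$ is injective for every $R$-module $A$; a *pure quotient* of $M$ is a module $N$ with a surjection $M\to N$ whose kernel is a pure submodule of $M$. A *Lucas cover* of $M$ is a homomorphism $f:C\to M$ with $C$ a Lucas module such that - for every Lucas module $C'$ the map $\mathrm{Hom}_R(C',C)\to\mathrm{Hom}_R(C',M)$, $g\mapsto f\circ g$, is surjective, and - every endomorphism $h$ of $C$ with $f=f\circ h$ is an isomorphism. Then the following statements hold. 1. Every pure quotient of a Lucas module is a Lucas module. 2. Every $R$-module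 has a Lucas cover. Moreover, the class of Lucas $R$-modules is definable: it is closed under direct products, pure submodules and direct limits of direct systems over (nonempty) directed index sets. -/

import Mathlib

universe u

/-- An ideal `I` of `R` is dense if `(0 :_R I) = {r ∈ R | I r = 0}` is zero. -/
def Ideal.IsDenseIdeal {R : Type u} [CommRing R] (I : Ideal R) : Prop :=
  ∀ r : R, (∀ a ∈ I, a * r = 0) → r = 0

/-- An ideal `I` is semi-regular if it contains a finitely generated dense ideal. -/
def Ideal.IsSemiRegular {R : Type u} [CommRing R] (I : Ideal R) : Prop :=
  ∃ J : Ideal R, J ≤ I ∧ J.FG ∧ J.IsDenseIdeal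

namespace LucasModule

/-- The set `𝒬` of finitely generated semi-regular ideals of `R`. -/
def QIdeals (R : Type u) [CommRing R] : Set (Ideal R) :=
  {I | I.FG ∧ I.IsSemiRegular}

/-- `tor_𝒬(M)`: the elements of `M` killed by some ideal in `𝒬`. -/
def torQ (R : Type u) [CommRing R] (M : Type u) [AddCommGroup M] [Module R M] : Set M :=
  {x | ∃ I ∈ QIdeals R, ∀ a ∈ I, a • x = 0}

/-- `M` is `𝒬`-torsion-free if `tor_𝒬(M) = 0`. -/
def IsQTorsionFree (R : Type u) [CommRing R] (M : Type u) [AddCommGroup M] [Module R M] : Prop :=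
  torQ R M = {0}

/-- `M` is a Lucas module if it is `𝒬`-torsion-free and `Ext¹_R(R/I, M) = 0` for all `I ∈ 𝒬`. -/
def IsLucas (R : Type u) [CommRing R] (M : Type u) [AddCommGroup M] [Module R M] : Prop :=
  IsQTorsionFree R M ∧ ∀ I ∈ QIdeals R,
    Subsingleton
      (CategoryTheory.Abelian.Ext.{u} (ModuleCat.of R (R ⧸ I)) (ModuleCat.of R M) 1)

/-- A class of `R`-modules. -/
abbrev ModuleClass (R : Type u) [CommRing R] : Type (u + 1) :=
  ∀ (M : Type u) [AddCommGroup M] [Module R M], Prop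

/-- The class `ℒ` of Lucas modules over `R`. -/
def lucasClass (R : Type u) [CommRing R] : ModuleClass R :=
  fun M _ _ => IsLucas R M

/-- `f : N → M` is a pure monomorphism if `A ⊗ N → A ⊗ M` is injective for every `R`-module `A`
(in particular `f` is injective, by `A = R`); so `f` identifies `N` with a pure submodule of `M`. -/
def IsPureMono {R : Type u} [CommRing R] {N M : Type u} [AddCommGroup N] [Module R N]
    [AddCommGroup M] [Module R M] (f : N →ₗ[R] M) : Prop :=
  ∀ (A : Type u) [AddCommGroup A] [Module R A], Function.Injective (f.lTensor A)

/-- `g : M → N` exhibits `N` as a pure quotient of `M`: it is onto and its kernel is a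
pure submodule of `M`. -/
def IsPureQuotient {R : Type u} [CommRing R] {M N : Type u} [AddCommGroup M] [Module R M]
    [AddCommGroup N] [Module R N] (g : M →ₗ[R] N) : Prop :=
  Function.Surjective g ∧ IsPureMono (LinearMap.ker g).subtype

/-- A class of modules is definable if it is closed under direct products, pure submodules and
direct limits (of direct systems over directed index sets). -/
structure IsDefinable {R : Type u} [CommRing R] (𝒞 : ModuleClass R) : Prop where
  prod_mem : ∀ (ι : Type u) (M : ι → Type u) [∀ i, AddCommGroup (M i)] [∀ i, Module R (M i)],
    (∀ i, 𝒞 (M i)) → 𝒞 (∀ i, M i)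
  pure_mem : ∀ (N M : Type u) [AddCommGroup N] [Module R N] [AddCommGroup M] [Module R M]
    (f : N →ₗ[R] M), IsPureMono f → 𝒞 M → 𝒞 N
  directLimit_mem : ∀ (ι : Type u) [DecidableEq ι] [Preorder ι] [IsDirectedOrder ι] [Nonempty ι]
    (M : ι → Type u) [∀ i, AddCommGroup (M i)] [∀ i, Module R (M i)]
    (φ : ∀ i j, i ≤ j → M i →ₗ[R] M j) [DirectedSystem M (fun i j h => φ i j h)],
    (∀ i, 𝒞 (M i)) → 𝒞 (Module.DirectLimit M φ)

/-- `f : C → M` is a `𝒞`-precover: `C ∈ 𝒞` and `Hom(C', C) → Hom(C', M)` is onto for `C' ∈ 𝒞`. -/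
def IsPrecover {R : Type u} [CommRing R] (𝒞 : ModuleClass R) {C M : Type u}
    [AddCommGroup C] [Module R C] [AddCommGroup M] [Module R M] (f : C →ₗ[R] M) : Prop :=
  𝒞 C ∧ ∀ (C' : Type u) [AddCommGroup C'] [Module R C'], 𝒞 C' →
    Function.Surjective (fun g : C' →ₗ[R] C => f ∘ₗ g)

/-- `f : C → M` is a `𝒞`-cover: a `𝒞`-precover such that every endomorphism `h` of `C` with
`f = f ∘ h` is an isomorphism. -/
def IsCover {R : Type u} [CommRing R] (𝒞 : ModuleClass R) {C M : Type u}
    [AddCommGroup C] [Module R C] [AddCommGroup M] [Module R M] (f : C →ₗ[R] M) : Prop :=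
  IsPrecover 𝒞 f ∧ ∀ h : C →ₗ[R] C, f = f ∘ₗ h → Function.Bijective h

end LucasModule

/-!
Call a finite family `a : Fin n → R` dense if the ideal it generates has zero annihilator. The
finitely generated semi-regular ideals are exactly the ideals generated by dense families, and `M`
is a Lucas module iff for every dense family `a` the beginning of the Koszul complex
`0 → M → Mⁿ → Mⁿˣⁿ` is exact (`LucasModule.isLucas_iff`). These are conditions on finite systems of
linear equations. A pure submodule solves every finite system that the ambient module solves
(`IsPureMono.exists_solution`), and finite homogeneous systems lift along pure quotients
(`IsPureQuotient.exists_lift`); this gives closure under pure submodules, pure quotients, direct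
products, direct sums and direct limits. Since taking character modules turns exact sequences around,
the double character module `M⋆⋆` of a Lucas module is also a Lucas module.

Covers are obtained in two stages.

*Precovers.* Up to isomorphism there is only a set of Lucas modules generated by countably many
elements, so there is a map `π : X₀ → M` from a Lucas module such that each finite system in a Lucas
module over `M` lifts to `X₀` over `M`. Let `K` be the kernel of `π`. Then `K` is pure in
`X₀ ×_M C` for each Lucas module `C` over `M`. The module `K⋆⋆` is pure-injective and contains `K` as
a pure submodule, so replacing `K` by `K⋆⋆` in `X₀` (a pushout `X`) makes all maps `C → M` lift to `X`
(`LiftsFiniteSystems.exists_lifts`). The pushout is a pure quotient of `X₀ × K⋆⋆`. In general `K` is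
only torsion-free, and then so is `X`; but if `M` is torsion-free, then `K` is a Lucas module, and then
so is `X`. Applying the construction first to `M` and then to the resulting torsion-free module gives
a precover of `M` (`exists_isPrecover`).

*From precovers to covers.* This stage is Enochs' argument and uses only closure under direct limits. Long well-ordered
chains of endomorphisms of a precover over `M`, continued at limit steps through the direct limit,
show first that some endomorphism `g` has a kernel which no further endomorphism enlarges
(`exists_stable_ker`). The direct limit of the iteration of `g` is a precover all of whose
endomorphisms over `M` are injective, and long chains once more show that these are surjective
(`surjective_of_forall_injective`).
-/

open TensorProduct

namespace LucasModule

variable {R : Type u} [CommRing R]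

/-! ### Lucas modules and the Koszul complex -/

/-- A finite family of ring elements is dense if the ideal it generates has zero annihilator. -/
def IsDenseFamily {n : ℕ} (a : Fin n → R) : Prop :=
  ∀ r : R, (∀ i, a i * r = 0) → r = 0

variable (R) in
/-- For each dense family `a`, the map `M → Mⁿ`, `x ↦ (aᵢ x)`, is injective. -/
def KoszulInjective (M : Type u) [AddCommGroup M] [Module R M] : Prop :=
  ∀ (n : ℕ) (a : Fin n → R), IsDenseFamily a → ∀ x : M, (∀ i, a i • x = 0) → x = 0

variable (R) in
/-- For each dense family `a`, the Koszul sequence `M → Mⁿ → Mⁿˣⁿ` is exact at `Mⁿ`, where the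
second map is `x ↦ (aᵢ xⱼ - aⱼ xᵢ)`. -/
def KoszulExact (M : Type u) [AddCommGroup M] [Module R M] : Prop :=
  ∀ (n : ℕ) (a : Fin n → R), IsDenseFamily a → ∀ x : Fin n → M,
    (∀ i j, a i • x j = a j • x i) → ∃ y : M, ∀ i, x i = a i • y

section Characterization

variable {M : Type u} [AddCommGroup M] [Module R M]

theorem span_range_mem_QIdeals {n : ℕ} {a : Fin n → R} (ha : IsDenseFamily a) :
    Ideal.span (Set.range a) ∈ QIdeals R := by
  have hfg : (Ideal.span (Set.range a)).FG :=
    Submodule.fg_span (Set.finite_range a)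
  exact ⟨hfg, _, le_rfl, hfg, fun r hr =>
    ha r fun i => hr _ (Ideal.subset_span ⟨i, rfl⟩)⟩

theorem exists_isDenseFamily_of_mem_QIdeals {I : Ideal R} (hI : I ∈ QIdeals R) :
    ∃ (n : ℕ) (a : Fin n → R), IsDenseFamily a ∧ Ideal.span (Set.range a) = I := by
  obtain ⟨hfg, J, hJI, -, hJ⟩ := hI
  obtain ⟨n, a, rfl⟩ := Submodule.fg_iff_exists_fin_generating_family.1 hfg
  refine ⟨n, a, fun r hr => hJ r fun b hb => ?_, rfl⟩
  have h : Submodule.span R (Set.range a) ≤ LinearMap.ker (LinearMap.toSpanSingleton R R r) := by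
    rw [Submodule.span_le]
    rintro _ ⟨i, rfl⟩
    simpa using hr i
  simpa using h (hJI hb)

theorem isQTorsionFree_iff : IsQTorsionFree R M ↔ KoszulInjective R M := by
  constructor
  · intro h n a ha x hx
    have : x ∈ torQ R M := by
      refine ⟨_, span_range_mem_QIdeals ha, fun b hb => ?_⟩
      have h : Submodule.span R (Set.range a) ≤
          LinearMap.ker (LinearMap.toSpanSingleton R M x) := by
        rw [Submodule.span_le]
        rintro _ ⟨i, rfl⟩
        simpa using hx i
      simpa using h hb
    rw [h] at this
    simpa using this
  · intro h
    apply Set.eq_singleton_iff_unique_mem.2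
    refine ⟨⟨⊤, ⟨Module.Finite.fg_top, ⊤, le_rfl, Module.Finite.fg_top, fun r hr => by
      simpa using hr 1 trivial⟩, fun a _ => smul_zero a⟩, ?_⟩
    rintro x ⟨I, hI, hx⟩
    obtain ⟨n, a, ha, rfl⟩ := exists_isDenseFamily_of_mem_QIdeals hI
    exact h n a ha x fun i => hx _ (Ideal.subset_span ⟨i, rfl⟩)

open CategoryTheory Abelian in
/-- `Ext¹(R/I, M)` vanishes exactly when every linear map `I → M` extends to `R`. -/
theorem subsingleton_ext_quotient_iff (I : Ideal R) :
    Subsingleton (Ext.{u} (ModuleCat.of R (R ⧸ I)) (ModuleCat.of R M) 1) ↔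
      ∀ f : I →ₗ[R] M, ∃ y : M, ∀ b : I, f b = (b : R) • y := by
  let S : ShortComplex (ModuleCat.{u} R) :=
    ShortComplex.mk (ModuleCat.ofHom I.subtype) (ModuleCat.ofHom I.mkQ) (by
      ext x
      exact (Submodule.Quotient.mk_eq_zero I).2 x.2)
  have hS : S.ShortExact :=
    { exact := by
        rw [ShortComplex.moduleCat_exact_iff]
        intro x hx
        exact ⟨⟨x, (Submodule.Quotient.mk_eq_zero I).1 hx⟩, rfl⟩
      mono_f := (ModuleCat.mono_iff_injective _).2 I.injective_subtype
      epi_g := (ModuleCat.epi_iff_surjective _).2 I.mkQ_surjective }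
  constructor
  · intro h f
    obtain ⟨x₂, hx₂⟩ := Ext.contravariant_sequence_exact₁ hS (ModuleCat.of R M)
      (Ext.mk₀ (ModuleCat.ofHom f : S.X₁ ⟶ ModuleCat.of R M)) (n₁ := 1) rfl
      (h.elim _ _)
    obtain ⟨g, rfl⟩ := (Ext.mk₀_bijective _ _).2 x₂
    rw [Ext.mk₀_comp_mk₀] at hx₂
    have hg := (Ext.mk₀_bijective _ _).1 hx₂
    refine ⟨g.hom (1 : R), fun b => ?_⟩
    have h1 : g.hom ((b : R)) = f b := congrArg (fun φ => φ.hom b) hg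
    rw [← h1, ← LinearMap.map_smul]
    congr 1
    exact (mul_one (b : R)).symm
  · intro h
    refine subsingleton_of_forall_eq 0 fun x₃ => ?_
    have : Projective S.X₂ := by
      have hR : Module.Projective R S.X₂ := inferInstanceAs (Module.Projective R R)
      exact (IsProjective.iff_projective _).1 hR
    obtain ⟨x₁, rfl⟩ := Ext.contravariant_sequence_exact₃ hS (ModuleCat.of R M) x₃
      (Ext.eq_zero_of_projective _) (n₀ := 0) rfl
    obtain ⟨f, rfl⟩ := (Ext.mk₀_bijective _ _).2 x₁
    obtain ⟨y, hy⟩ := h f.hom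
    have hf : f = S.f ≫ ModuleCat.ofHom (LinearMap.toSpanSingleton R M y) := by
      ext b
      exact hy b
    rw [hf, ← Ext.mk₀_comp_mk₀]
    exact hS.extClass_comp_assoc _

/-- A module is a Lucas module iff each dense family `a` makes the beginning
`0 → M → Mⁿ → Mⁿˣⁿ` of the Koszul complex exact. Once `M` is torsion-free, the Koszul relations
between `aᵢ` and `aⱼ` are the only ones needed to define a linear map on the ideal generated by
`a`, although that ideal need not be finitely presented. -/
theorem isLucas_iff : IsLucas R M ↔ KoszulInjective R M ∧ KoszulExact R M := by
  rw [IsLucas, isQTorsionFree_iff]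
  refine and_congr_right fun htf => ⟨fun h n a ha x hx => ?_, fun h I hI => ?_⟩
  · have hext := (subsingleton_ext_quotient_iff (M := M) _).1 (h _ (span_range_mem_QIdeals ha))
    let φ : (Fin n → R) →ₗ[R] R := Fintype.linearCombination R a
    let ψ : (Fin n → R) →ₗ[R] M := Fintype.linearCombination R x
    have hker : LinearMap.ker φ ≤ LinearMap.ker ψ := by
      intro r hr
      refine htf n a ha _ fun i => ?_
      simp only [φ, LinearMap.mem_ker, Fintype.linearCombination_apply, smul_eq_mul] at hr
      simp only [ψ, Fintype.linearCombination_apply, Finset.smul_sum]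
      calc ∑ j, a i • r j • x j = ∑ j, (r j * a j) • x i := by
            refine Finset.sum_congr rfl fun j _ => ?_
            rw [smul_comm, hx, smul_smul]
        _ = 0 := by rw [← Finset.sum_smul, hr, zero_smul]
    have hrange : LinearMap.range φ = Ideal.span (Set.range a) :=
      Fintype.range_linearCombination R a
    rw [← hrange] at hext
    obtain ⟨y, hy⟩ := hext ((LinearMap.ker φ).liftQ ψ hker ∘ₗ φ.quotKerEquivRange.symm.toLinearMap)
    refine ⟨y, fun i => ?_⟩
    have h1 := hy ⟨φ (Pi.single i 1), LinearMap.mem_range_self _ _⟩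
    have h2 : φ.quotKerEquivRange.symm ⟨φ (Pi.single i 1), LinearMap.mem_range_self _ _⟩ =
        (LinearMap.ker φ).mkQ (Pi.single i 1) := φ.quotKerEquivRange_symm_apply_image _ _
    simp only [LinearMap.comp_apply, LinearEquiv.coe_coe, h2] at h1
    simpa [φ, ψ, Fintype.linearCombination_apply_single] using h1
  · obtain ⟨n, a, ha, rfl⟩ := exists_isDenseFamily_of_mem_QIdeals hI
    rw [subsingleton_ext_quotient_iff]
    intro f
    have hmem : ∀ i, a i ∈ Ideal.span (Set.range a) := fun i => Ideal.subset_span ⟨i, rfl⟩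
    obtain ⟨y, hy⟩ := h n a ha (fun i => f ⟨a i, hmem i⟩) fun i j => by
      rw [← f.map_smul, ← f.map_smul]
      congr 1
      ext
      exact mul_comm _ _
    refine ⟨y, fun b => ?_⟩
    have hb : (b : R) ∈ LinearMap.range (Fintype.linearCombination R a) := by
      rw [Fintype.range_linearCombination]
      exact b.2
    obtain ⟨r, hr⟩ := hb
    have : b = ∑ i, r i • (⟨a i, hmem i⟩ : Ideal.span (Set.range a)) := by
      ext
      simpa [Fintype.linearCombination_apply] using hr.symm
    rw [this, map_sum]
    simp only [map_smul, hy, AddSubmonoidClass.coe_finsetSum, Submodule.coe_smul, Finset.sum_smul,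
      smul_assoc]

theorem IsLucas.koszulInjective (h : IsLucas R M) : KoszulInjective R M := (isLucas_iff.1 h).1

theorem IsLucas.koszulExact (h : IsLucas R M) : KoszulExact R M := (isLucas_iff.1 h).2

end Characterization

/-! ### Purity and finite systems of linear equations -/

section Purity

variable {N M : Type u} [AddCommGroup N] [Module R N] [AddCommGroup M] [Module R M]

theorem IsPureMono.injective {f : N →ₗ[R] M} (hf : IsPureMono f) : Function.Injective f := by
  intro x y h
  have h1 : (1 : R) ⊗ₜ[R] x = (1 : R) ⊗ₜ[R] y := hf R (by simp [h])
  simpa using congrArg (TensorProduct.lid R N) h1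

/-- A finite system of linear equations with constants in a pure submodule which is solvable in the
ambient module is solvable in the submodule. The tensor product to look at is with the cokernel of
the transposed coefficient matrix. -/
theorem IsPureMono.exists_solution {f : N →ₗ[R] M} (hf : IsPureMono f) {ι κ : Type} [Fintype ι]
    [Fintype κ] (c : ι → κ → R) (k : ι → N) (u : κ → M) (h : ∀ t, f (k t) = ∑ j, c t j • u j) :
    ∃ v : κ → N, ∀ t, k t = ∑ j, c t j • v j := by
  classical
  let B : (κ → R) →ₗ[R] (ι → R) := Fintype.linearCombination R fun j t => c t j
  let m : ι → (ι → R) ⧸ LinearMap.range B := fun t => (LinearMap.range B).mkQ (Pi.single t 1)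
  have hm_sum : ∀ w : ι → R, ∑ t, w t • m t = (LinearMap.range B).mkQ w := by
    intro w
    simp only [m, ← map_smul, ← map_sum]
    congr 1
    ext t
    simp [Finset.sum_apply, Pi.single_apply]
  have hspan : Submodule.span R (Set.range m) = ⊤ := by
    rw [eq_top_iff]
    intro q _
    obtain ⟨w, rfl⟩ := (LinearMap.range B).mkQ_surjective q
    rw [← hm_sum]
    exact Submodule.sum_mem _ fun t _ => Submodule.smul_mem _ _ (Submodule.subset_span ⟨t, rfl⟩)
  have hzero : ∑ t, m t ⊗ₜ[R] k t = 0 := by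
    apply hf
    rw [map_zero, map_sum]
    simp only [LinearMap.lTensor_tmul, h, tmul_sum, tmul_smul]
    rw [Finset.sum_comm]
    refine Finset.sum_eq_zero fun j _ => ?_
    simp only [smul_tmul']
    rw [← sum_tmul, hm_sum fun t => c t j]
    have : (LinearMap.range B).mkQ (fun t => c t j) = 0 := by
      rw [Submodule.mkQ_apply, Submodule.Quotient.mk_eq_zero]
      exact ⟨Pi.single j 1, by simp [B, Fintype.linearCombination_apply_single]⟩
    rw [this, zero_tmul]
  obtain ⟨p, e, y, hy, he⟩ := vanishesTrivially_of_sum_tmul_eq_zero R hspan hzero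
  have he' : ∀ l, ∃ d : κ → R, B d = fun t => e t l := by
    intro l
    have := he l
    rw [hm_sum fun t => e t l, Submodule.mkQ_apply, Submodule.Quotient.mk_eq_zero] at this
    exact this
  choose d hd using he'
  refine ⟨fun j => ∑ l, d l j • y l, fun t => ?_⟩
  rw [hy]
  simp only [Finset.smul_sum, smul_smul]
  rw [Finset.sum_comm]
  refine Finset.sum_congr rfl fun l _ => ?_
  rw [← Finset.sum_smul, ← congrFun (hd l) t]
  simp [B, Fintype.linearCombination_apply, mul_comm]

/-- Finite systems of homogeneous linear equations lift along pure quotients. -/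
theorem IsPureQuotient.exists_lift {g : M →ₗ[R] N} (hg : IsPureQuotient g) {ι κ : Type} [Fintype ι]
    [Fintype κ] (c : ι → κ → R) (y : κ → N) (h : ∀ t, ∑ j, c t j • y j = 0) :
    ∃ x : κ → M, (∀ j, g (x j) = y j) ∧ ∀ t, ∑ j, c t j • x j = 0 := by
  choose z hz using fun j => hg.1 (y j)
  obtain ⟨v, hv⟩ := hg.2.exists_solution c
    (fun t => ⟨∑ j, c t j • z j, by simp [hz, h]⟩) z fun t => rfl
  refine ⟨fun j => z j - v j, fun j => by simp [hz], fun t => ?_⟩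
  have := congrArg Subtype.val (hv t)
  simp only [AddSubmonoidClass.coe_finsetSum, Submodule.coe_smul] at this
  simp only [smul_sub, Finset.sum_sub_distrib, this, sub_self]

/-- A family `m` spanning `A` allows to write each element of `A ⊗ N` as `∑ mᵢ ⊗ kᵢ`. -/
theorem exists_eq_sum_tmul_of_span_eq_top {A : Type u} [AddCommGroup A] [Module R A] {n : ℕ}
    {m : Fin n → A} (hm : Submodule.span R (Set.range m) = ⊤) (z : A ⊗[R] N) :
    ∃ k : Fin n → N, z = ∑ i, m i ⊗ₜ[R] k i := by
  induction z with
  | zero => exact ⟨0, by simp⟩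
  | tmul a b =>
    obtain ⟨r, rfl⟩ := (Submodule.mem_span_range_iff_exists_fun R).1
      (show a ∈ Submodule.span R (Set.range m) from hm ▸ Submodule.mem_top)
    exact ⟨fun i => r i • b, by simp [sum_tmul, smul_tmul]⟩
  | add x y hx hy =>
    obtain ⟨k, rfl⟩ := hx
    obtain ⟨l, rfl⟩ := hy
    exact ⟨k + l, by simp [tmul_add, Finset.sum_add_distrib]⟩

/-- A surjection along which all finite homogeneous systems lift has a pure kernel. -/
theorem isPureQuotient_of_exists_lift {g : M →ₗ[R] N} (hg : Function.Surjective g)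
    (h : ∀ (m n : ℕ) (c : Fin m → Fin n → R) (y : Fin n → N), (∀ t, ∑ j, c t j • y j = 0) →
      ∃ x : Fin n → M, (∀ j, g (x j) = y j) ∧ ∀ t, ∑ j, c t j • x j = 0) :
    IsPureQuotient g := by
  refine ⟨hg, fun A _ _ => (injective_iff_map_eq_zero _).2 fun z hz => ?_⟩
  -- Everything happens over a finitely generated submodule of `A`.
  obtain ⟨P, hP, t, ht⟩ := Submodule.exists_fg_le_eq_rTensor_subtype z
  have ht0 : LinearMap.rTensor M P.subtype ((LinearMap.ker g).subtype.lTensor P t) = 0 := by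
    rw [← LinearMap.comp_apply, LinearMap.rTensor_comp_lTensor, ← LinearMap.lTensor_comp_rTensor,
      LinearMap.comp_apply, ← ht, hz]
  obtain ⟨Q, hPQ, hQ, h0⟩ := TensorProduct.eq_zero_of_fg_of_subtype_eq_zero hP ht0
  rw [← LinearMap.comp_apply, LinearMap.rTensor_comp_lTensor, ← LinearMap.lTensor_comp_rTensor,
    LinearMap.comp_apply] at h0
  suffices hs : LinearMap.rTensor (LinearMap.ker g) (Submodule.inclusion hPQ) t = 0 by
    rw [ht, ← Submodule.subtype_comp_inclusion _ _ hPQ, LinearMap.rTensor_comp,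
      LinearMap.comp_apply, hs, map_zero]
  have : Module.Finite R Q := Module.Finite.iff_fg.2 hQ
  obtain ⟨n, m, hm⟩ := Module.Finite.exists_fin (R := R) (M := Q)
  obtain ⟨k, hk⟩ := exists_eq_sum_tmul_of_span_eq_top hm
    (LinearMap.rTensor (LinearMap.ker g) (Submodule.inclusion hPQ) t)
  rw [hk] at h0 ⊢
  rw [map_sum] at h0
  obtain ⟨p, c, y, hy, hc⟩ := vanishesTrivially_of_sum_tmul_eq_zero R hm
    (n := fun i => (k i : M)) h0
  beta_reduce at hy
  -- Correcting `y` by a lift of its image in `N` moves it into the kernel.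
  obtain ⟨x, hx, hx0⟩ := h n p c (fun j => g (y j)) fun i => by
    have := (k i).2
    rw [LinearMap.mem_ker, hy] at this
    simpa using this
  refine sum_tmul_eq_zero_of_vanishesTrivially R
    ⟨p, c, fun j => ⟨y j - x j, by simp [hx]⟩, fun i => ?_, hc⟩
  ext
  simp only [AddSubmonoidClass.coe_finsetSum, Submodule.coe_smul]
  simp only [smul_sub, Finset.sum_sub_distrib, hx0, sub_zero, hy]

theorem isPureMono_of_comp {P : Type u} [AddCommGroup P] [Module R P] {f : N →ₗ[R] M}
    {g : M →ₗ[R] P} (h : IsPureMono (g ∘ₗ f)) : IsPureMono f := by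
  intro A _ _
  have := h A
  rw [LinearMap.lTensor_comp] at this
  exact Function.Injective.of_comp this

/-- The quotient by the image of a pure monomorphism is a pure quotient. -/
theorem IsPureMono.isPureQuotient_mkQ {f : N →ₗ[R] M} (hf : IsPureMono f) :
    IsPureQuotient (LinearMap.range f).mkQ := by
  refine ⟨Submodule.mkQ_surjective _, fun A _ _ => ?_⟩
  rw [Submodule.ker_mkQ]
  let e : N ≃ₗ[R] LinearMap.range f := LinearEquiv.ofInjective f hf.injective
  have he : (LinearMap.range f).subtype = f ∘ₗ e.symm.toLinearMap := by
    ext x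
    obtain ⟨y, rfl⟩ := e.surjective x
    simp [e]
  rw [he, LinearMap.lTensor_comp]
  exact (hf A).comp (LinearEquiv.lTensor A e.symm).injective

end Purity

/-! ### Closure properties of Lucas modules -/

section Closure

variable {N M : Type u} [AddCommGroup N] [Module R N] [AddCommGroup M] [Module R M]

theorem KoszulInjective.of_injective (f : N →ₗ[R] M) (hf : Function.Injective f)
    (hM : KoszulInjective R M) : KoszulInjective R N := fun n a ha x hx =>
  hf <| by
    rw [map_zero]
    exact hM n a ha _ fun i => by rw [← map_smul, hx, map_zero]

theorem IsLucas.of_linearEquiv (e : N ≃ₗ[R] M) (hM : IsLucas R M) : IsLucas R N := by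
  refine isLucas_iff.2 ⟨.of_injective e.toLinearMap e.injective hM.koszulInjective,
    fun n a ha x hx => ?_⟩
  obtain ⟨y, hy⟩ := hM.koszulExact n a ha (fun i => e (x i)) fun i j => by
    rw [← map_smul, hx, map_smul]
  exact ⟨e.symm y, fun i => e.injective (by simp [hy])⟩

theorem IsPureMono.isLucas {f : N →ₗ[R] M} (hf : IsPureMono f) (hM : IsLucas R M) :
    IsLucas R N := by
  refine isLucas_iff.2 ⟨.of_injective f hf.injective hM.koszulInjective, fun n a ha x hx => ?_⟩
  obtain ⟨y, hy⟩ := hM.koszulExact n a ha (fun i => f (x i)) fun i j => by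
    rw [← map_smul, hx, map_smul]
  obtain ⟨v, hv⟩ := hf.exists_solution (fun i (_ : Unit) => a i) x (fun _ => y) (by simpa using hy)
  exact ⟨v (), by simpa using hv⟩

theorem IsPureQuotient.koszulInjective {g : M →ₗ[R] N} (hg : IsPureQuotient g)
    (hM : KoszulInjective R M) : KoszulInjective R N := by
  intro n a ha y hy
  obtain ⟨x, hx, hx0⟩ := hg.exists_lift (fun i (_ : Unit) => a i) (fun _ => y) (by simpa using hy)
  rw [← hx (), hM n a ha (x ()) (by simpa using hx0), map_zero]

theorem IsPureQuotient.isLucas {g : M →ₗ[R] N} (hg : IsPureQuotient g) (hM : IsLucas R M) :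
    IsLucas R N := by
  refine isLucas_iff.2 ⟨hg.koszulInjective hM.koszulInjective, fun n a ha y hy => ?_⟩
  -- Lift the solution `y` of the Koszul relations to a solution in `M`.
  obtain ⟨x, hx, hx0⟩ := hg.exists_lift
    (fun (t : Fin n × Fin n) l => Pi.single (M := fun _ => R) t.2 (a t.1) l -
      Pi.single (M := fun _ => R) t.1 (a t.2) l) y fun t => by
    simp [sub_smul, Finset.sum_sub_distrib, Pi.single_apply, ite_smul, hy]
  obtain ⟨z, hz⟩ := hM.koszulExact n a ha x fun i j => by
    have := hx0 (i, j)
    simpa [sub_smul, Finset.sum_sub_distrib, Pi.single_apply, ite_smul, sub_eq_zero] using this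
  exact ⟨g z, fun i => by rw [← hx, hz, map_smul]⟩

/-- The kernel of a map from a Lucas module to a torsion-free module is a Lucas module. -/
theorem IsLucas.ker (hM : IsLucas R M) (hN : KoszulInjective R N) (g : M →ₗ[R] N) :
    IsLucas R (LinearMap.ker g) := by
  refine isLucas_iff.2 ⟨.of_injective _ (LinearMap.ker g).injective_subtype hM.koszulInjective,
    fun n a ha x hx => ?_⟩
  obtain ⟨y, hy⟩ := hM.koszulExact n a ha (fun i => (x i : M)) fun i j =>
    congrArg Subtype.val (hx i j)
  refine ⟨⟨y, hN n a ha _ fun i => ?_⟩, fun i => Subtype.ext (hy i)⟩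
  rw [← map_smul, ← hy]
  exact (x i).2

theorem KoszulInjective.prod (hM : KoszulInjective R M) (hN : KoszulInjective R N) :
    KoszulInjective R (M × N) := fun n a ha _ hx =>
  Prod.ext (hM n a ha _ fun i => congrArg Prod.fst (hx i))
    (hN n a ha _ fun i => congrArg Prod.snd (hx i))

theorem IsLucas.prod (hM : IsLucas R M) (hN : IsLucas R N) : IsLucas R (M × N) := by
  refine isLucas_iff.2 ⟨hM.koszulInjective.prod hN.koszulInjective, fun n a ha x hx => ?_⟩
  obtain ⟨y, hy⟩ := hM.koszulExact n a ha (fun i => (x i).1) fun i j => congrArg Prod.fst (hx i j)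
  obtain ⟨z, hz⟩ := hN.koszulExact n a ha (fun i => (x i).2) fun i j => congrArg Prod.snd (hx i j)
  exact ⟨(y, z), fun i => Prod.ext (hy i) (hz i)⟩

end Closure

section Families

variable {ι : Type u} {M : ι → Type u} [∀ i, AddCommGroup (M i)] [∀ i, Module R (M i)]

theorem IsLucas.pi (h : ∀ i, IsLucas R (M i)) : IsLucas R (∀ i, M i) := by
  refine isLucas_iff.2 ⟨fun n a ha x hx => ?_, fun n a ha x hx => ?_⟩
  · ext s
    exact (h s).koszulInjective n a ha _ fun i => congrFun (hx i) s
  · choose y hy using fun s => (h s).koszulExact n a ha (fun i => x i s) fun i j =>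
      congrFun (hx i j) s
    exact ⟨y, fun i => funext fun s => hy s i⟩

open DirectSum in
theorem IsLucas.directSum [DecidableEq ι] (h : ∀ i, IsLucas R (M i)) : IsLucas R (⨁ i, M i) := by
  classical
  refine isLucas_iff.2 ⟨fun n a ha x hx => ?_, fun n a ha x hx => ?_⟩
  · ext s
    exact (h s).koszulInjective n a ha _ fun i => DFunLike.congr_fun (hx i) s
  · choose y hy using fun s => (h s).koszulExact n a ha (fun i => x i s) fun i j =>
      DFunLike.congr_fun (hx i j) s
    refine ⟨DFinsupp.mk (Finset.univ.biUnion fun i => DFinsupp.support (x i)) fun s => y s,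
      fun i => DFinsupp.ext fun s => ?_⟩
    rw [DFinsupp.smul_apply, DFinsupp.mk_apply]
    split_ifs with hs
    · exact hy s i
    · rw [smul_zero]
      by_contra hne
      exact hs (Finset.mem_biUnion.2 ⟨i, Finset.mem_univ _, DFinsupp.mem_support_iff.2 hne⟩)

/-- In a direct limit, a finite family lifts to a single stage. -/
theorem exists_of_fin [Preorder ι] [DecidableEq ι] [IsDirectedOrder ι] [Nonempty ι]
    (φ : ∀ i j, i ≤ j → M i →ₗ[R] M j) {n : ℕ} (x : Fin n → Module.DirectLimit M φ) :
    ∃ (s : ι) (z : Fin n → M s), ∀ i, Module.DirectLimit.of R ι M φ s (z i) = x i := by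
  choose s z hz using fun i => Module.DirectLimit.exists_of (x i)
  obtain ⟨t, ht⟩ := Finite.exists_le s
  exact ⟨t, fun i => φ _ _ (ht i) (z i), fun i => by rw [Module.DirectLimit.of_f, hz]⟩

/-- In a direct limit, a finite family of elements of one stage which vanish in the limit vanish
at a common later stage. -/
theorem exists_le_forall_eq_zero [Preorder ι] [DecidableEq ι] [IsDirectedOrder ι]
    (φ : ∀ i j, i ≤ j → M i →ₗ[R] M j) [DirectedSystem M fun i j h => φ i j h]
    {κ : Type} [Finite κ] {s : ι} (z : κ → M s)
    (hz : ∀ k, Module.DirectLimit.of R ι M φ s (z k) = 0) :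
    ∃ (t : ι) (hst : s ≤ t), ∀ k, φ s t hst (z k) = 0 := by
  have : Nonempty ι := ⟨s⟩
  choose t ht h0 using fun k => Module.DirectLimit.of.zero_exact (hz k)
  obtain ⟨r, hr⟩ := Finite.exists_le fun o : Option κ => o.elim s t
  refine ⟨r, hr none, fun k => ?_⟩
  have := DirectedSystem.map_map (f := fun i j h => φ i j h) (ht k) (hr (some k)) (z k)
  rw [← this, h0, map_zero]

theorem IsLucas.directLimit [Preorder ι] [DecidableEq ι] [IsDirectedOrder ι] [Nonempty ι]
    (φ : ∀ i j, i ≤ j → M i →ₗ[R] M j) [DirectedSystem M fun i j h => φ i j h]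
    (h : ∀ i, IsLucas R (M i)) : IsLucas R (Module.DirectLimit M φ) := by
  refine isLucas_iff.2 ⟨fun n a ha x hx => ?_, fun n a ha x hx => ?_⟩
  · obtain ⟨s, z, rfl⟩ := Module.DirectLimit.exists_of x
    obtain ⟨t, hst, ht⟩ := exists_le_forall_eq_zero φ (fun i => a i • z) fun i => by
      rw [map_smul, hx]
    rw [← Module.DirectLimit.of_f (hij := hst),
      (h t).koszulInjective n a ha (φ s t hst z) fun i => by rw [← map_smul, ht], map_zero]
  · obtain ⟨s, z, hz⟩ := exists_of_fin φ x
    obtain ⟨t, hst, ht⟩ := exists_le_forall_eq_zero φ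
      (fun k : Fin n × Fin n => a k.1 • z k.2 - a k.2 • z k.1) fun k => by
      rw [map_sub, map_smul, map_smul, hz, hz, hx, sub_self]
    obtain ⟨y, hy⟩ := (h t).koszulExact n a ha (fun i => φ s t hst (z i)) fun i j => by
      rw [← map_smul, ← map_smul, ← sub_eq_zero, ← map_sub]
      exact ht (i, j)
    exact ⟨Module.DirectLimit.of R ι M φ t y, fun i => by
      rw [← map_smul, ← hy, Module.DirectLimit.of_f, hz]⟩

theorem isDefinable_lucasClass : IsDefinable (lucasClass R) where
  prod_mem _ _ _ _ h := IsLucas.pi h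
  pure_mem _ _ _ _ _ _ _ hf hM := hf.isLucas hM
  directLimit_mem _ _ _ _ _ _ _ _ φ _ h := IsLucas.directLimit φ h

end Families

/-! ### Character modules -/

section Characters

variable {N M P : Type u} [AddCommGroup N] [Module R N] [AddCommGroup M] [Module R M]
  [AddCommGroup P] [Module R P]

/-- A character which vanishes on the kernel of a linear map extends along that map. -/
theorem exists_character_comp_eq (f : N →ₗ[R] M) (χ : CharacterModule N)
    (h : ∀ x, f x = 0 → χ x = 0) : ∃ θ : CharacterModule M, ∀ x, θ (f x) = χ x := by
  let f' : N ⧸ LinearMap.ker f →ₗ[R] M := (LinearMap.ker f).liftQ f le_rfl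
  have hf' : Function.Injective f' := by
    rw [← LinearMap.ker_eq_bot]
    exact Submodule.ker_liftQ_eq_bot _ _ _ le_rfl
  let χ' : CharacterModule (N ⧸ LinearMap.ker f) :=
    QuotientAddGroup.lift (LinearMap.ker f).toAddSubgroup χ fun x hx => h x hx
  obtain ⟨θ, hθ⟩ := CharacterModule.dual_surjective_of_injective f' hf' χ'
  exact ⟨θ, fun x => DFunLike.congr_fun hθ ((LinearMap.ker f).mkQ x)⟩

theorem character_sum_apply {ι : Type*} (s : Finset ι) (χ : ι → CharacterModule M) (x : M) :
    (∑ i ∈ s, χ i) x = ∑ i ∈ s, χ i x :=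
  map_sum (AddMonoidHom.mk' (fun c : CharacterModule M => c x) fun _ _ => rfl) χ s

/-- The character `x ↦ ∑ χᵢ(xᵢ)` of a finite power. -/
def piCharacter {n : ℕ} (χ : Fin n → CharacterModule M) : CharacterModule (Fin n → M) :=
  AddMonoidHom.mk' (fun x => ∑ i, χ i (x i)) fun x y => by
    simp [Finset.sum_add_distrib]

theorem piCharacter_apply {n : ℕ} (χ : Fin n → CharacterModule M) (x : Fin n → M) :
    piCharacter χ x = ∑ i, χ i (x i) := rfl

theorem piCharacter_single {n : ℕ} (χ : Fin n → CharacterModule M) (l : Fin n) (x : M) :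
    piCharacter χ (Pi.single l x) = χ l x := by
  rw [piCharacter_apply, Finset.sum_eq_single l]
  · rw [Pi.single_eq_same]
  · intro i _ hi
    rw [Pi.single_eq_of_ne hi, map_zero]
  · simp

/-- The dual of the injectivity of `M → Mⁿ`. -/
theorem KoszulInjective.exists_character_eq_sum (hM : KoszulInjective R M) {n : ℕ} {a : Fin n → R}
    (ha : IsDenseFamily a) (χ : CharacterModule M) :
    ∃ θ : Fin n → CharacterModule M, χ = ∑ i, a i • θ i := by
  obtain ⟨θ, hθ⟩ := exists_character_comp_eq
    (LinearMap.pi fun i => a i • LinearMap.id : M →ₗ[R] (Fin n → M)) χ fun x hx => by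
      rw [hM n a ha x fun i => congrFun hx i, map_zero]
  refine ⟨fun i => CharacterModule.dual (LinearMap.single R (fun _ => M) i) θ,
    CharacterModule.ext _ fun x => ?_⟩
  rw [← hθ, character_sum_apply, ← Finset.univ_sum_single
    ((LinearMap.pi fun i => a i • LinearMap.id : M →ₗ[R] (Fin n → M)) x), map_sum]
  rfl

/-- The dual of the exactness of `M → Mⁿ → Mⁿˣⁿ`. -/
theorem KoszulExact.exists_character_eq_sum (hM : KoszulExact R M) {n : ℕ} {a : Fin n → R}
    (ha : IsDenseFamily a) (χ : Fin n → CharacterModule M) (hχ : ∑ i, a i • χ i = 0) :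
    ∃ θ : Fin n → Fin n → CharacterModule M, ∀ j, χ j = ∑ i, a i • (θ i j - θ j i) := by
  let d : (Fin n → M) →ₗ[R] (Fin n × Fin n → M) :=
    LinearMap.pi fun t => a t.1 • LinearMap.proj t.2 - a t.2 • LinearMap.proj t.1
  obtain ⟨θ, hθ⟩ := exists_character_comp_eq d (piCharacter χ) fun x hx => by
    obtain ⟨y, hy⟩ := hM n a ha x fun i j => sub_eq_zero.1 (congrFun hx (i, j))
    have := DFunLike.congr_fun hχ y
    rw [character_sum_apply] at this
    simp only [piCharacter_apply, hy]
    exact this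
  refine ⟨fun i j => CharacterModule.dual (LinearMap.single R (fun _ => M) (i, j)) θ, fun l =>
    CharacterModule.ext _ fun x => ?_⟩
  have h2 : d (Pi.single l x) =
      ∑ i, (Pi.single (i, l) (a i • x) - Pi.single (l, i) (a i • x)) := by
    ext ⟨p, q⟩
    simp [d, Pi.single_apply, Finset.sum_apply, Prod.ext_iff, ite_and]
  rw [← piCharacter_single χ, ← hθ, h2, character_sum_apply, map_sum]
  exact Finset.sum_congr rfl fun i _ => map_sub θ _ _

variable (R M) in
/-- The canonical map of a module to its double character module. -/
def toBidual : M →ₗ[R] CharacterModule (CharacterModule M) where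
  toFun x := AddMonoidHom.mk' (fun χ => χ x) fun _ _ => rfl
  map_add' x y := CharacterModule.ext _ fun χ => map_add χ x y
  map_smul' _ _ := rfl

/-- Every character of `A ⊗ M` extends to `A ⊗ M⋆⋆`, since `Hom(A, M⋆)` is a retract of
`Hom(A, M⋆⋆⋆)`. -/
theorem isPureMono_toBidual : IsPureMono (toBidual R M) := by
  intro A _ _
  rw [injective_iff_map_eq_zero]
  refine fun z hz => CharacterModule.eq_zero_of_character_apply fun c => ?_
  let φ : A →ₗ[R] CharacterModule M := CharacterModule.curry c
  let c' : CharacterModule (A ⊗[R] CharacterModule (CharacterModule M)) :=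
    CharacterModule.uncurry (toBidual R (CharacterModule M) ∘ₗ φ)
  have h : ∀ z, c' ((toBidual R M).lTensor A z) = c z := by
    intro z
    induction z with
    | zero => simp
    | tmul a x => rfl
    | add x y hx hy => rw [map_add, map_add, map_add, hx, hy]
  rw [← h, hz, map_zero]

/-- Character modules are pure-injective. -/
theorem IsPureMono.exists_extension {f : N →ₗ[R] M} (hf : IsPureMono f)
    (g : N →ₗ[R] CharacterModule P) : ∃ h : M →ₗ[R] CharacterModule P, h ∘ₗ f = g :=
  rTensor_injective_iff_lcomp_surjective.1
    ((LinearMap.lTensor_inj_iff_rTensor_inj P f).1 (hf P)) g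

theorem KoszulInjective.bidual (hM : KoszulInjective R M) :
    KoszulInjective R (CharacterModule (CharacterModule M)) := by
  refine fun n a ha u hu => CharacterModule.ext _ fun χ => ?_
  obtain ⟨θ, rfl⟩ := hM.exists_character_eq_sum ha χ
  rw [map_sum]
  exact Finset.sum_eq_zero fun i _ => DFunLike.congr_fun (hu i) (θ i)

/-- The solution of `uᵢ = aᵢ w` in `M⋆⋆` is determined on sums `∑ aᵢ χᵢ` by `w(∑ aᵢ χᵢ) = ∑ uᵢ(χᵢ)`.
The Koszul relations between the `uᵢ` and the exactness for `M` make this well-defined. -/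
theorem IsLucas.bidual (hM : IsLucas R M) :
    IsLucas R (CharacterModule (CharacterModule M)) := by
  refine isLucas_iff.2 ⟨hM.koszulInjective.bidual, fun n a ha u hu => ?_⟩
  obtain ⟨w, hw⟩ := exists_character_comp_eq
    (∑ i, a i • LinearMap.proj i : (Fin n → CharacterModule M) →ₗ[R] CharacterModule M)
    (piCharacter u) fun χ hχ => by
      obtain ⟨θ, hθ⟩ := hM.koszulExact.exists_character_eq_sum ha χ (by simpa using hχ)
      have h1 : ∀ j, u j (χ j) = ∑ i, ((a i • u j) (θ i j) - (a i • u j) (θ j i)) := fun j => by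
        rw [hθ, map_sum]
        exact Finset.sum_congr rfl fun i _ => by rw [smul_sub, map_sub]; rfl
      rw [piCharacter_apply, Finset.sum_congr rfl fun j _ => h1 j]
      simp only [Finset.sum_sub_distrib]
      rw [sub_eq_zero, Finset.sum_comm]
      exact Finset.sum_congr rfl fun i _ => Finset.sum_congr rfl fun j _ => by rw [hu]
  refine ⟨w, fun i => CharacterModule.ext _ fun χ => ?_⟩
  rw [← piCharacter_single u, ← hw, CharacterModule.smul_apply]
  congr 1
  simp [Pi.single_apply]

end Characters

/-! ### Countably generated Lucas modules -/

section Terms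

variable (R) in
/-- Terms for the elements that can be obtained from a sequence of elements of a Lucas module by the
module operations and by solving the systems `xᵢ = aᵢ y` in `y`. Their only purpose is to bound the
size of the Lucas submodule generated by countably many elements. -/
inductive KoszulTerm : Type u
  | var (k : ℕ) : KoszulTerm
  | smul (r : R) (t : KoszulTerm) : KoszulTerm
  | add (s t : KoszulTerm) : KoszulTerm
  | sol (n : ℕ) (a : Fin n → R) (x : Fin n → KoszulTerm) : KoszulTerm

variable {C : Type u} [AddCommGroup C] [Module R C]

open Classical in
/-- The value of a term in a module. A system without a solution is given the value `0`. -/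
noncomputable def KoszulTerm.eval (v : ℕ → C) : KoszulTerm R → C
  | var k => v k
  | smul r t => r • t.eval v
  | add s t => s.eval v + t.eval v
  | sol _ a x => if h : ∃ y, ∀ i, (x i).eval v = a i • y then h.choose else 0

/-- The submodule of all values of terms. -/
noncomputable def KoszulTerm.rangeEval (v : ℕ → C) : Submodule R C where
  carrier := Set.range (KoszulTerm.eval (R := R) v)
  zero_mem' := ⟨.smul 0 (.var 0), by rw [KoszulTerm.eval, zero_smul]⟩
  add_mem' := by
    rintro _ _ ⟨s, rfl⟩ ⟨t, rfl⟩
    exact ⟨.add s t, by rw [KoszulTerm.eval]⟩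
  smul_mem' := by
    rintro r _ ⟨t, rfl⟩
    exact ⟨.smul r t, by rw [KoszulTerm.eval]⟩

theorem KoszulTerm.isLucas_rangeEval (hC : IsLucas R C) (v : ℕ → C) :
    IsLucas R (KoszulTerm.rangeEval (R := R) v) := by
  refine isLucas_iff.2 ⟨.of_injective _ (Submodule.injective_subtype _) hC.koszulInjective,
    fun n a ha x hx => ?_⟩
  have h : ∃ y, ∀ i, (x i : C) = a i • y :=
    hC.koszulExact n a ha (fun i => (x i : C)) fun i j => congrArg Subtype.val (hx i j)
  choose t ht using fun i => (x i).2
  simp only [← ht] at h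
  refine ⟨⟨(KoszulTerm.sol n a t).eval v, _, rfl⟩, fun i => Subtype.ext ?_⟩
  rw [Submodule.coe_smul, ← ht]
  simp only [KoszulTerm.eval, dif_pos h]
  exact h.choose_spec i

theorem KoszulTerm.range_linearCombination_eval (v : ℕ → C) :
    LinearMap.range (Finsupp.linearCombination R (KoszulTerm.eval (R := R) v)) =
      KoszulTerm.rangeEval v := by
  rw [Finsupp.range_linearCombination]
  exact Submodule.span_eq (KoszulTerm.rangeEval (R := R) v)

variable (R) in
/-- A set of representatives for the Lucas modules generated by countably many elements: the
quotients of the free module on all terms which are Lucas modules, together with a map to `M`. -/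
structure SmallLucasOver (M : Type u) [AddCommGroup M] [Module R M] : Type u where
  /-- The submodule of relations. -/
  relations : Submodule R (KoszulTerm R →₀ R)
  isLucas : IsLucas R ((KoszulTerm R →₀ R) ⧸ relations)
  /-- The structure map. -/
  hom : ((KoszulTerm R →₀ R) ⧸ relations) →ₗ[R] M

section

variable {M : Type u} [AddCommGroup M] [Module R M] (s : SmallLucasOver R M)

/-- The underlying module of a small Lucas module over `M`. -/
def SmallLucasOver.Carrier : Type u := (KoszulTerm R →₀ R) ⧸ s.relations

noncomputable instance : AddCommGroup s.Carrier :=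
  inferInstanceAs (AddCommGroup ((KoszulTerm R →₀ R) ⧸ s.relations))

noncomputable instance : Module R s.Carrier :=
  inferInstanceAs (Module R ((KoszulTerm R →₀ R) ⧸ s.relations))

/-- The structure map `s.hom`, as a map on `s.Carrier`. -/
def SmallLucasOver.map : s.Carrier →ₗ[R] M := s.hom

end

/-- A map `π : X → M` lifts finite systems if, for every map `f` from a Lucas module `C` to `M`,
a finite family in `C` satisfying finitely many linear relations is sent by `f` to a
family in `M` which lifts along `π` to a family satisfying the same relations. -/
def LiftsFiniteSystems {X M : Type u} [AddCommGroup X] [Module R X] [AddCommGroup M] [Module R M]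
    (π : X →ₗ[R] M) : Prop :=
  ∀ (C : Type u) [AddCommGroup C] [Module R C], IsLucas R C → ∀ (f : C →ₗ[R] M) (m n : ℕ)
    (c : Fin m → Fin n → R) (y : Fin n → C), (∀ t, ∑ j, c t j • y j = 0) →
      ∃ x : Fin n → X, (∀ j, π (x j) = f (y j)) ∧ ∀ t, ∑ j, c t j • x j = 0

open DirectSum in
/-- The direct sum of all small Lucas modules over `M` lifts finite systems. -/
theorem exists_isLucas_liftsFiniteSystems (M : Type u) [AddCommGroup M] [Module R M] :
    ∃ (X : Type u) (_ : AddCommGroup X) (_ : Module R X) (π : X →ₗ[R] M),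
      IsLucas R X ∧ LiftsFiniteSystems π := by
  classical
  let π : (⨁ s : SmallLucasOver R M, s.Carrier) →ₗ[R] M :=
    DirectSum.toModule R _ M SmallLucasOver.map
  refine ⟨_, inferInstance, inferInstance, π,
    IsLucas.directSum (M := SmallLucasOver.Carrier) fun s => s.isLucas, ?_⟩
  intro C _ _ hC f m n c y hy
  let v : ℕ → C := fun k => if h : k < n then y ⟨k, h⟩ else 0
  let e := Finsupp.linearCombination R (KoszulTerm.eval (R := R) v)
  have hL : IsLucas R ((KoszulTerm R →₀ R) ⧸ LinearMap.ker e) := by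
    have := KoszulTerm.isLucas_rangeEval hC v
    rw [← KoszulTerm.range_linearCombination_eval] at this
    exact this.of_linearEquiv e.quotKerEquivRange
  let s : SmallLucasOver R M := ⟨LinearMap.ker e, hL, f ∘ₗ (LinearMap.ker e).liftQ e le_rfl⟩
  let ē : s.Carrier →ₗ[R] C := (LinearMap.ker e).liftQ e le_rfl
  have hē : Function.Injective ē :=
    LinearMap.ker_eq_bot.1 (Submodule.ker_liftQ_eq_bot _ _ _ le_rfl)
  let z : Fin n → s.Carrier := fun j => (LinearMap.ker e).mkQ (Finsupp.single (.var j) 1)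
  have hz : ∀ j, ē (z j) = y j := fun j => by
    have : e (Finsupp.single (.var j) 1) = y j := by
      simp [e, KoszulTerm.eval, v]
    exact this
  refine ⟨fun j => DirectSum.lof R _ SmallLucasOver.Carrier s (z j), fun j => ?_, fun t => ?_⟩
  · rw [DirectSum.toModule_lof]
    exact congrArg f (hz j)
  · simp only [← map_smul, ← map_sum]
    have : ∑ j, c t j • z j = 0 := hē (by
      rw [map_sum, map_zero, ← hy t]
      exact Finset.sum_congr rfl fun j _ => by rw [map_smul, hz])
    rw [this, map_zero]

end Terms

/-! ### Precovers by pure-injective pushouts -/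

section Precovers

variable {M X₀ : Type u} [AddCommGroup M] [Module R M] [AddCommGroup X₀] [Module R X₀]

/-- If `π : X₀ → M` lifts finite systems, then the kernel `K` of `π` is pure in each pullback
`X₀ ×_M C` with `C` a Lucas module. Pushing out along the embedding of `K` into the pure-injective
module `K⋆⋆` therefore splits these pullbacks, and each `C → M` lifts to the pushout. As
`K → X₀ × K⋆⋆` is pure, the pushout is a pure quotient of `X₀ × K⋆⋆`. -/
theorem LiftsFiniteSystems.exists_lifts {π : X₀ →ₗ[R] M} (hπ : LiftsFiniteSystems π) :
    ∃ (X : Type u) (_ : AddCommGroup X) (_ : Module R X) (ρ : X →ₗ[R] M)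
      (q : X₀ × CharacterModule (CharacterModule (LinearMap.ker π)) →ₗ[R] X),
      IsPureQuotient q ∧ ∀ (C : Type u) [AddCommGroup C] [Module R C], IsLucas R C →
        ∀ f : C →ₗ[R] M, ∃ h : C →ₗ[R] X, ρ ∘ₗ h = f := by
  let K := LinearMap.ker π
  let D := CharacterModule (CharacterModule K)
  let δ : K →ₗ[R] X₀ × D := LinearMap.prod K.subtype (toBidual R K)
  have hδ : IsPureMono δ :=
    isPureMono_of_comp (g := LinearMap.snd R X₀ D) (isPureMono_toBidual (M := K))
  let q := (LinearMap.range δ).mkQ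
  let ρ : (X₀ × D) ⧸ LinearMap.range δ →ₗ[R] M :=
    (LinearMap.range δ).liftQ (π ∘ₗ LinearMap.fst R X₀ D) (by
      rintro _ ⟨k, rfl⟩
      exact k.2)
  refine ⟨_, inferInstance, inferInstance, ρ, q, hδ.isPureQuotient_mkQ, fun C _ _ hC f => ?_⟩
  let E : Submodule R (X₀ × C) :=
    LinearMap.ker (π ∘ₗ LinearMap.fst R X₀ C - f ∘ₗ LinearMap.snd R X₀ C)
  have hE : ∀ e : E, π e.1.1 = f e.1.2 := fun e => sub_eq_zero.1 e.2
  let p : E →ₗ[R] C := LinearMap.snd R X₀ C ∘ₗ E.subtype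
  have hlift : ∀ (m n : ℕ) (c : Fin m → Fin n → R) (y : Fin n → C),
      (∀ t, ∑ j, c t j • y j = 0) →
      ∃ x : Fin n → E, (∀ j, p (x j) = y j) ∧ ∀ t, ∑ j, c t j • x j = 0 := by
    intro m n c y hy
    obtain ⟨x, hx, hx0⟩ := hπ C hC f m n c y hy
    refine ⟨fun j => ⟨(x j, y j), sub_eq_zero.2 (hx j)⟩, fun j => rfl, fun t => ?_⟩
    ext
    · simpa [Prod.fst_sum] using hx0 t
    · simpa [Prod.snd_sum] using hy t
  have hsurj : Function.Surjective p := fun y => by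
    obtain ⟨x, hx, -⟩ := hlift 0 1 (fun _ _ => 0) (fun _ => y) fun t => t.elim0
    exact ⟨x 0, hx 0⟩
  have hpure := (isPureQuotient_of_exists_lift hsurj hlift).2
  -- The kernel of `E → C` is identified with `K` by the first projection.
  let ε : LinearMap.ker p →ₗ[R] K :=
    (LinearMap.fst R X₀ C ∘ₗ E.subtype ∘ₗ (LinearMap.ker p).subtype).codRestrict K fun e => by
      have h2 : e.1.1.2 = 0 := e.2
      simp [K, hE, h2]
  obtain ⟨J, hJ⟩ := hpure.exists_extension (toBidual R K ∘ₗ ε)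
  let g : E →ₗ[R] (X₀ × D) ⧸ LinearMap.range δ :=
    q ∘ₗ LinearMap.prod (LinearMap.fst R X₀ C ∘ₗ E.subtype) J
  have hg : LinearMap.ker p ≤ LinearMap.ker g := fun e he => by
    refine (Submodule.Quotient.mk_eq_zero _).2 ⟨ε ⟨e, he⟩, Prod.ext rfl ?_⟩
    exact (LinearMap.congr_fun hJ ⟨e, he⟩).symm
  refine ⟨(LinearMap.ker p).liftQ g hg ∘ₗ (p.quotKerEquivOfSurjective hsurj).symm.toLinearMap, ?_⟩
  ext y
  obtain ⟨e, rfl⟩ := hsurj y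
  have : (p.quotKerEquivOfSurjective hsurj).symm (p e) = (LinearMap.ker p).mkQ e := by
    rw [LinearEquiv.symm_apply_eq]
    rfl
  simp only [LinearMap.comp_apply, LinearEquiv.coe_coe, this]
  exact hE e

/-- All maps from Lucas modules to `M` factor through a single torsion-free module over `M`. -/
theorem exists_torsionFree_lifts (M : Type u) [AddCommGroup M] [Module R M] :
    ∃ (X : Type u) (_ : AddCommGroup X) (_ : Module R X) (ρ : X →ₗ[R] M), KoszulInjective R X ∧
      ∀ (C : Type u) [AddCommGroup C] [Module R C], IsLucas R C →
        ∀ f : C →ₗ[R] M, ∃ h : C →ₗ[R] X, ρ ∘ₗ h = f := by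
  obtain ⟨X₀, _, _, π, hX₀, hπ⟩ := exists_isLucas_liftsFiniteSystems (R := R) M
  obtain ⟨X, _, _, ρ, q, hq, h⟩ := hπ.exists_lifts
  refine ⟨X, _, _, ρ, hq.koszulInjective ?_, h⟩
  have hK : KoszulInjective R (LinearMap.ker π) :=
    .of_injective _ (Submodule.injective_subtype _) hX₀.koszulInjective
  exact hX₀.koszulInjective.prod hK.bidual

theorem exists_isPrecover_of_koszulInjective (hM : KoszulInjective R M) :
    ∃ (X : Type u) (_ : AddCommGroup X) (_ : Module R X) (ρ : X →ₗ[R] M),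
      IsPrecover (lucasClass R) ρ := by
  obtain ⟨X₀, _, _, π, hX₀, hπ⟩ := exists_isLucas_liftsFiniteSystems (R := R) M
  obtain ⟨X, _, _, ρ, q, hq, h⟩ := hπ.exists_lifts
  exact ⟨X, _, _, ρ, hq.isLucas (hX₀.prod (hX₀.ker hM π).bidual), h⟩

theorem exists_isPrecover (M : Type u) [AddCommGroup M] [Module R M] :
    ∃ (X : Type u) (_ : AddCommGroup X) (_ : Module R X) (ρ : X →ₗ[R] M),
      IsPrecover (lucasClass R) ρ := by
  obtain ⟨Y, _, _, σ, hY, h⟩ := exists_torsionFree_lifts (R := R) M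
  obtain ⟨X, _, _, ρ, hX, hρ⟩ := exists_isPrecover_of_koszulInjective hY
  refine ⟨X, _, _, σ ∘ₗ ρ, hX, fun C _ _ hC f => ?_⟩
  obtain ⟨g, rfl⟩ := h C hC f
  obtain ⟨k, hk⟩ := hρ C hC g
  exact ⟨k, by simpa [LinearMap.comp_assoc] using congrArg (σ ∘ₗ ·) hk⟩

end Precovers

/-! ### From precovers to covers -/

section Covers

variable {𝒞 : ModuleClass R} {X M : Type u} [AddCommGroup X] [Module R X] [AddCommGroup M]
  [Module R M] {f : X →ₗ[R] M}

/-- A coherent family of endomorphisms `T γ α` (for `α < γ` in `S`) of a precover `X → M` over `M`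
has a cocone with values in `X`: the direct limit of the copies of `X` along the family maps to `X`
over `M`. -/
theorem exists_cocone (h𝒞 : IsDefinable 𝒞) (hf : IsPrecover 𝒞 f) {W : Type u} [LinearOrder W]
    (S : Set W) (T : W → W → X →ₗ[R] X) (hTf : ∀ γ ∈ S, ∀ α ∈ S, α < γ → f ∘ₗ T γ α = f)
    (hT : ∀ γ ∈ S, ∀ β ∈ S, ∀ α ∈ S, α < β → β < γ → T γ β ∘ₗ T β α = T γ α) :
    ∃ c : W → X →ₗ[R] X, (∀ α ∈ S, f ∘ₗ c α = f) ∧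
      ∀ γ ∈ S, ∀ α ∈ S, α < γ → c γ ∘ₗ T γ α = c α := by
  classical
  rcases S.eq_empty_or_nonempty with rfl | ⟨s, hs⟩
  · exact ⟨fun _ => LinearMap.id, fun α hα => hα.elim, fun γ hγ => hγ.elim⟩
  have : Nonempty S := ⟨⟨s, hs⟩⟩
  let φ : ∀ i j : S, i ≤ j → X →ₗ[R] X := fun i j _ => if i = j then LinearMap.id else T j i
  have hφ : ∀ {i j : S} (h : i < j), φ i j h.le = T j i := fun h => if_neg h.ne
  have hφ' : ∀ i : S, φ i i le_rfl = LinearMap.id := fun i => if_pos rfl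
  have : DirectedSystem (fun _ : S => X) fun i j h => φ i j h :=
    { map_self := fun i x => by simp [hφ']
      map_map := fun k j i hij hjk x => by
        rcases hij.eq_or_lt with rfl | hij
        · simp [hφ']
        rcases hjk.eq_or_lt with rfl | hjk
        · simp [hφ']
        rw [hφ hij, hφ hjk, hφ (hij.trans hjk)]
        exact LinearMap.congr_fun (hT _ k.2 _ j.2 _ i.2 hij hjk) x }
  let L := Module.DirectLimit (fun _ : S => X) φ
  have hF : ∀ (i j : S) (hij : i ≤ j) (x : X), f (φ i j hij x) = f x := fun i j hij x => by
    rcases hij.eq_or_lt with rfl | hij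
    · simp [hφ']
    · rw [hφ hij]
      exact LinearMap.congr_fun (hTf _ j.2 _ i.2 hij) x
  let F : L →ₗ[R] M := Module.DirectLimit.lift R S (fun _ : S => X) φ (fun _ => f) hF
  obtain ⟨g, hg⟩ := hf.2 L (h𝒞.directLimit_mem S (fun _ => X) φ fun _ => hf.1) F
  have hg' : f ∘ₗ g = F := hg
  refine ⟨fun α => if hα : α ∈ S then
    g ∘ₗ Module.DirectLimit.of R S (fun _ : S => X) φ ⟨α, hα⟩ else LinearMap.id, ?_, ?_⟩
  · intro α hα
    ext x
    simp only [dif_pos hα]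
    rw [← LinearMap.comp_assoc, hg']
    exact Module.DirectLimit.lift_of (f := φ) (i := ⟨α, hα⟩) (fun _ => f) hF x
  · intro γ hγ α hα hlt
    ext x
    simp only [dif_pos hγ, dif_pos hα]
    have hlt' : (⟨α, hα⟩ : S) < ⟨γ, hγ⟩ := hlt
    have := Module.DirectLimit.of_f (R := R) (f := φ) (hij := hlt'.le) (x := x)
    rw [hφ hlt'] at this
    exact congrArg g this

/-- Transfinite iteration of endomorphisms of a precover `f : X → M` over `M`. Along a well-order
`W`, there is a coherent family of endomorphisms `T β α` which factor as `H c ∘ c α`, where `c` is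
some cocone under the part of the family below `β`, and the endomorphism `H c` may be prescribed in
terms of `c`. -/
theorem exists_coherent_family (h𝒞 : IsDefinable 𝒞) (hf : IsPrecover 𝒞 f) {W : Type u}
    [LinearOrder W] [WellFoundedLT W] (H : (W → X →ₗ[R] X) → X →ₗ[R] X)
    (hH : ∀ c, f ∘ₗ H c = f) :
    ∃ T : W → W → X →ₗ[R] X, ∀ β,
      (∀ α < β, f ∘ₗ T β α = f) ∧ (∀ γ < β, ∀ α < γ, T β γ ∘ₗ T γ α = T β α) ∧
      ∃ c : W → X →ₗ[R] X, (∀ α < β, f ∘ₗ c α = f) ∧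
        (∀ γ < β, ∀ α < γ, c γ ∘ₗ T γ α = c α) ∧ ∀ α, T β α = H c ∘ₗ c α := by
  classical
  let IsCocone (β : W) (P : ∀ γ < β, W → X →ₗ[R] X) (c : W → X →ₗ[R] X) : Prop :=
    (∀ α < β, f ∘ₗ c α = f) ∧ ∀ γ (hγ : γ < β), ∀ α < γ, c γ ∘ₗ P γ hγ α = c α
  let step (β : W) (P : ∀ γ < β, W → X →ₗ[R] X) : W → X →ₗ[R] X :=
    if h : ∃ c, IsCocone β P c then fun α => H h.choose ∘ₗ h.choose α else fun _ => LinearMap.id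
  let T : W → W → X →ₗ[R] X := (wellFounded_lt (α := W)).fix step
  have hstep : ∀ β, T β = step β fun γ _ => T γ := fun β => WellFounded.fix_eq _ _ _
  refine ⟨T, fun β => ?_⟩
  induction β using WellFoundedLT.induction with
  | ind β ih =>
    have hex : ∃ c, IsCocone β (fun γ _ => T γ) c := by
      obtain ⟨c, hc, hc'⟩ := exists_cocone h𝒞 hf (Set.Iio β) T
        (fun γ hγ α _ hlt => (ih γ hγ).1 α hlt)
        (fun γ hγ δ _ α _ h1 h2 => (ih γ hγ).2.1 δ h2 α h1)
      exact ⟨c, hc, fun γ hγ α hα => hc' γ hγ α (hα.trans hγ) hα⟩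
    have hT : ∀ α, T β α = H hex.choose ∘ₗ hex.choose α := fun α => by
      rw [hstep]
      simp only [step, dif_pos hex]
    obtain ⟨hc, hc'⟩ := hex.choose_spec
    refine ⟨fun α hα => ?_, fun γ hγ α hα => ?_, hex.choose, hc, hc', hT⟩
    · rw [hT, ← LinearMap.comp_assoc, hH, hc α hα]
    · rw [hT, hT, LinearMap.comp_assoc, hc' γ hγ α hα]

theorem exists_wellOrder_forall_not_injective (A : Type u) :
    ∃ (W : Type u) (_ : LinearOrder W) (_ : WellFoundedLT W),
      ∀ f : W → A, ¬ Function.Injective f := by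
  obtain ⟨o, h⟩ := exists_wellFoundedLT (Set A)
  exact ⟨Set A, o, h, Function.cantor_injective⟩

/-- A precover has an endomorphism `g` over `M` whose kernel is not enlarged by further
endomorphisms. Otherwise a long chain of endomorphisms would give too many submodules of `X`. -/
theorem exists_stable_ker (h𝒞 : IsDefinable 𝒞) (hf : IsPrecover 𝒞 f) :
    ∃ g : X →ₗ[R] X, f ∘ₗ g = f ∧
      ∀ h : X →ₗ[R] X, f ∘ₗ h = f → LinearMap.ker (h ∘ₗ g) ≤ LinearMap.ker g := by
  classical
  by_contra! hcon
  choose! e hef he using hcon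
  obtain ⟨W, _, _, hW⟩ := exists_wellOrder_forall_not_injective (Option (Submodule R X))
  have : Nonempty W := not_isEmpty_iff.1 fun _ => hW isEmptyElim fun a => isEmptyElim a
  obtain ⟨b, -, hb⟩ := (wellFounded_lt (α := W)).has_min Set.univ Set.univ_nonempty
  obtain ⟨T, hT⟩ := exists_coherent_family h𝒞 hf (W := W)
    (fun c => if f ∘ₗ c b = f then e (c b) else LinearMap.id) fun c => by
      split_ifs with h
      · exact hef _ h
      · exact LinearMap.comp_id f
  have hlt : ∀ α β, b < α → α < β → ¬ LinearMap.ker (T β b) ≤ LinearMap.ker (T α b) := by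
    intro α β hα hαβ hle
    obtain ⟨-, -, c, hc, hc', hTc⟩ := hT β
    have hcb := hc b (hα.trans hαβ)
    rw [hTc, if_pos hcb] at hle
    refine he _ hcb (hle.trans ?_)
    rw [← hc' α hαβ b hα]
    exact LinearMap.ker_le_ker_comp _ _
  have hbα : ∀ α, α ≠ b → b < α := fun α hα => lt_of_le_of_ne (not_lt.1 (hb α trivial)) hα.symm
  refine hW
    (fun β : W => if β = b then none else some (LinearMap.ker (T β b))) fun α β hαβ => ?_
  dsimp only at hαβ
  split_ifs at hαβ with h1 h2 h2
  · rw [h1, h2]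
  · have hker := Option.some_injective _ hαβ
    rcases lt_trichotomy α β with h | h | h
    · exact (hlt α β (hbα α h1) h hker.ge).elim
    · exact h
    · exact (hlt β α (hbα β h2) h hker.le).elim

/-- If `X → M` is a precover all of whose endomorphisms over `M` are injective, then these
endomorphisms are surjective. Otherwise a long chain of copies of `X` would give, through the
images in the last copy, too many submodules of `X`. -/
theorem surjective_of_forall_injective (h𝒞 : IsDefinable 𝒞) (hf : IsPrecover 𝒞 f)
    (hinj : ∀ h : X →ₗ[R] X, f ∘ₗ h = f → Function.Injective h) (h : X →ₗ[R] X)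
    (hh : f ∘ₗ h = f) : Function.Surjective h := by
  by_contra hsurj
  obtain ⟨x, hx⟩ := not_forall.1 hsurj
  obtain ⟨W, _, _, hW⟩ := exists_wellOrder_forall_not_injective (Submodule R X)
  obtain ⟨T, hT⟩ := exists_coherent_family h𝒞 hf (W := W) (fun _ => h) fun _ => hh
  obtain ⟨c, hcf, hc⟩ := exists_cocone h𝒞 hf Set.univ T
    (fun γ _ α _ hlt => (hT γ).1 α hlt) (fun γ _ β _ α _ h1 h2 => (hT γ).2.1 β h2 α h1)
  have hlt : ∀ α γ, α < γ → LinearMap.range (c γ) ≠ LinearMap.range (c α) := by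
    intro α γ hαγ heq
    obtain ⟨-, -, c', -, -, hc'⟩ := hT γ
    have hmem : c γ x ∈ LinearMap.range (c α) := heq ▸ LinearMap.mem_range_self _ x
    obtain ⟨y, hy⟩ := hmem
    rw [← hc γ trivial α trivial hαγ, hc'] at hy
    exact hx ⟨c' α y, hinj _ (hcf γ trivial) hy⟩
  refine hW (fun α : W => LinearMap.range (c α)) fun α β hαβ => ?_
  rcases lt_trichotomy α β with h | h | h
  · exact (hlt α β h hαβ.symm).elim
  · exact h
  · exact (hlt β α h hαβ).elim

/-- The direct limit of a precover along an endomorphism with stable kernel is a precover all of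
whose endomorphisms over `M` are injective. -/
theorem exists_isPrecover_forall_injective (h𝒞 : IsDefinable 𝒞) (hf : IsPrecover 𝒞 f) :
    ∃ (Y : Type u) (_ : AddCommGroup Y) (_ : Module R Y) (f' : Y →ₗ[R] M), IsPrecover 𝒞 f' ∧
      ∀ h : Y →ₗ[R] Y, f' ∘ₗ h = f' → Function.Injective h := by
  classical
  obtain ⟨g, hg, hstab⟩ := exists_stable_ker h𝒞 hf
  have hgn : ∀ n : ℕ, f ∘ₗ (g ^ n : Module.End R X) = f := by
    intro n
    induction n with
    | zero => exact LinearMap.comp_id f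
    | succ n ih => rw [pow_succ, Module.End.mul_eq_comp, ← LinearMap.comp_assoc, ih, hg]
  let φ : ∀ i j : ULift.{u} ℕ, i ≤ j → X →ₗ[R] X :=
    fun i j _ => (g ^ (j.down - i.down) : Module.End R X)
  have : DirectedSystem (fun _ : ULift.{u} ℕ => X) fun i j h => φ i j h :=
    { map_self := fun i x => by simp [φ]
      map_map := fun k j i hij hjk x => by
        have h1 : i.down ≤ j.down := hij
        have h2 : j.down ≤ k.down := hjk
        simp only [φ]
        rw [← Module.End.mul_apply, ← pow_add]
        congr 2
        omega }
  let Y := Module.DirectLimit (fun _ : ULift.{u} ℕ => X) φ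
  let ι : ULift.{u} ℕ → X →ₗ[R] Y := Module.DirectLimit.of R _ (fun _ : ULift.{u} ℕ => X) φ
  have hf' : ∀ (i j : ULift.{u} ℕ) (hij : i ≤ j) (x : X), f (φ i j hij x) = f x :=
    fun _ _ _ x => LinearMap.congr_fun (hgn _) x
  let f' : Y →ₗ[R] M :=
    Module.DirectLimit.lift R _ (fun _ : ULift.{u} ℕ => X) φ (fun _ => f) hf'
  have hf'ι : ∀ i, f' ∘ₗ ι i = f := fun i => LinearMap.ext fun x =>
    Module.DirectLimit.lift_of (f := φ) (i := i) (fun _ => f) hf' x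
  have hι : ∀ (n : ℕ) (x : X), ι ⟨n + 1⟩ (g x) = ι ⟨n⟩ x := by
    intro n x
    have hle : (⟨n⟩ : ULift.{u} ℕ) ≤ ⟨n + 1⟩ := Nat.le_succ n
    have := Module.DirectLimit.of_f (R := R) (f := φ) (hij := hle) (x := x)
    simpa [φ] using this
  have hY : IsPrecover 𝒞 f' := by
    refine ⟨h𝒞.directLimit_mem _ (fun _ => X) φ fun _ => hf.1, fun C _ _ hC k => ?_⟩
    obtain ⟨l, rfl⟩ := hf.2 C hC k
    exact ⟨ι ⟨0⟩ ∘ₗ l, by simp only [← LinearMap.comp_assoc, hf'ι]⟩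
  refine ⟨Y, _, _, f', hY, fun h hh => (injective_iff_map_eq_zero h).2 fun y hy => ?_⟩
  obtain ⟨⟨n⟩, x, rfl⟩ := Module.DirectLimit.exists_of y
  obtain ⟨r, hr⟩ := hf.2 Y hY.1 f'
  have hr' : f ∘ₗ r = f' := hr
  -- The endomorphism `r ∘ h ∘ ι (n + 1)` of `X` does not enlarge the kernel of `g`.
  have hx : g x = 0 := hstab (r ∘ₗ h ∘ₗ ι ⟨n + 1⟩)
    (by rw [← LinearMap.comp_assoc, hr', ← LinearMap.comp_assoc, hh, hf'ι]) (by
      change r (h (ι ⟨n + 1⟩ (g x))) = 0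
      rw [hι]
      exact (congrArg r hy).trans (map_zero r))
  change ι ⟨n⟩ x = 0
  rw [← hι, hx, map_zero]

/-- A definable class has covers wherever it has precovers. -/
theorem IsPrecover.exists_isCover (h𝒞 : IsDefinable 𝒞) (hf : IsPrecover 𝒞 f) :
    ∃ (C : Type u) (_ : AddCommGroup C) (_ : Module R C) (f' : C →ₗ[R] M), IsCover 𝒞 f' := by
  obtain ⟨Y, _, _, f', hf', hinj⟩ := exists_isPrecover_forall_injective h𝒞 hf
  exact ⟨Y, _, _, f', hf', fun h hh =>
    ⟨hinj h hh.symm, surjective_of_forall_injective h𝒞 hf' hinj h hh.symm⟩⟩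

end Covers

end LucasModule

theorem theorem3p6 (R : Type u) [CommRing R] :
    -- every pure quotient of a Lucas module is a Lucas module
    (∀ (M N : Type u) [AddCommGroup M] [Module R M] [AddCommGroup N] [Module R N]
      (g : M →ₗ[R] N), LucasModule.IsPureQuotient g →
        LucasModule.IsLucas R M → LucasModule.IsLucas R N) ∧
    -- every module has a Lucas cover
    (∀ (M : Type u) [AddCommGroup M] [Module R M],
      ∃ (C : Type u) (_ : AddCommGroup C) (_ : Module R C) (f : C →ₗ[R] M),
        LucasModule.IsCover (LucasModule.lucasClass R) f) ∧
    -- the class of Lucas modules is definable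
    LucasModule.IsDefinable (LucasModule.lucasClass R) := by
  refine ⟨fun M N _ _ _ _ g hg hM => hg.isLucas hM, fun M _ _ => ?_,
    LucasModule.isDefinable_lucasClass⟩
  obtain ⟨X, _, _, f, hf⟩ := LucasModule.exists_isPrecover (R := R) M
  exact hf.exists_isCover LucasModule.isDefinable_lucasClass
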